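/- Let $\phi_0$ be a probability distribution on $\mathbb{R}^d$ whose one-dimensional marginals are continuous, i.e. $\phi_0(\{y : y_i = t\}) = 0$ for every component $i$ and every $t\in\mathbb{R}$ (for instance, $\phi_0$ has a density). Let $N\ge 1$, $K\ge 1$, and let $\pi_1,\dots,\pi_K>0$ be target probabilities with $\sum_{j=1}^K \pi_j = 1$ such that every $L_j := \pi_j N$ is an integer. Let $TR=(x_1,\dots,x_N)$ be i.i.d. samples from $\phi_0$. The QuantTree partition $\{S_j\}_{j=1}^K$ of $\mathbb{R}^d$ is built from $TR$ as follows. For $k=1,\dots,K-1$, let $R_k = \mathbb{R}^d\setminus\bigcup_{j<k}S_j$; choose at random a component $i_k\in\{1,\dots,d\}$ and a side $\gamma_k\in\{0,1\}$; sort the $i_k$-th components of the training points that lie in $R_k$ as $z_{(1)}\le\dots\le z_{(N_k)}$; and set $S_k=\{y\in R_k : y_{i_k}\le z_{(L_k)}\}$ if $\gamma_k=0$, and $S_k=\{y\in R_k : y_{i_k}\ge z_{(N_k-L_k+1)}\}$ if $\gamma_k=1$. Finally, $S_K=\mathbb{R}^d\setminus\bigcup_{j<K}S_j$. The random choices $(i_k,\gamma_k)_{k<K}$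 may have any joint law (in particular, they may be independent and uniform), and are independent of $TR$. Then the vector of true bin probabilities $p_j=\phi_0(S_j)$, $j=1,\dots,K$, which is random through $TR$ and the random choices, follows the Dirichlet distribution $$(p_1,\dots,p_K)\sim\mathcal{D}(\pi_1N,\ \dots,\ \pi_{K-1}N,\ \pi_KN+1).$$ (For $K=1$ the Dirichlet distribution is the point mass at $1$.) -/

import Mathlib

open MeasureTheory ProbabilityTheory

noncomputable section

/-- Density of the Dirichlet distribution with parameters `a 0, …, a n` with respect to Lebesgue
measure, in the first `n` coordinates of the simplex (the last one is `1 - ∑ i, x i`). -/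
def dirichletPDFReal {n : ℕ} (a : Fin (n + 1) → ℝ) (x : Fin n → ℝ) : ℝ :=
  open Classical in
  if (∀ i, 0 < x i) ∧ ∑ i, x i < 1 then
    Real.Gamma (∑ j, a j) / (∏ j, Real.Gamma (a j)) *
      ((∏ i, x i ^ (a i.castSucc - 1)) * (1 - ∑ i, x i) ^ (a (Fin.last n) - 1))
  else 0

/-- The Dirichlet distribution with (positive) parameters `a 0, …, a n`, as a measure on `ℝ^(n+1)`:
the law of `(x 0, …, x (n-1), 1 - ∑ i, x i)` where `x` has the Dirichlet density. For `n = 0` it is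
the point mass at `1`. -/
def dirichletMeasure {n : ℕ} (a : Fin (n + 1) → ℝ) : Measure (Fin (n + 1) → ℝ) :=
  ((volume : Measure (Fin n → ℝ)).withDensity
      (fun x => ENNReal.ofReal (dirichletPDFReal a x))).map
    (fun x => Fin.snoc (α := fun _ => ℝ) x (1 - ∑ i, x i))

namespace QuantTree

/-- The `r`-th smallest element (`r = 1, 2, …`), counted with multiplicity, of a finite multiset of
real numbers with at least `r` elements. -/
def orderStat (s : Multiset ℝ) (r : ℕ) : ℝ :=
  (s.sort (· ≤ ·)).getD (r - 1) 0

/-- The `i`-th components of those training points that lie in the region `R`. -/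
def componentsIn {d N : ℕ} (x : Fin N → Fin d → ℝ) (R : Set (Fin d → ℝ)) (i : Fin d) :
    Multiset ℝ :=
  open Classical in
  (Finset.univ.filter (fun m => x m ∈ R)).val.map (fun m => x m i)

/-- The bin cut out of the region `R` of not yet assigned points: for the choice `c = (i, γ)` of a
component and a side, it is the part of `R` where the `i`-th component is at most the `l`-th
smallest value (`γ = false`), respectively at least the `l`-th largest value (`γ = true`), taken by
that component on the training points in `R`. -/
def cut {d N : ℕ} (x : Fin N → Fin d → ℝ) (R : Set (Fin d → ℝ)) (c : Fin d × Bool) (l : ℕ) :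
    Set (Fin d → ℝ) :=
  match c with
  | (i, false) => {y | y ∈ R ∧ y i ≤ orderStat (componentsIn x R i) l}
  | (i, true) => {y | y ∈ R ∧
      orderStat (componentsIn x R i) ((componentsIn x R i).card - l + 1) ≤ y i}

/-- What is left of `ℝ^d` after the first `k` of the `n` cuts have been made. -/
def remaining {d N n : ℕ} (x : Fin N → Fin d → ℝ) (c : Fin n → Fin d × Bool)
    (L : Fin (n + 1) → ℕ) : (k : ℕ) → k ≤ n → Set (Fin d → ℝ)
  | 0, _ => Set.univ
  | k + 1, h =>
    remaining x c L k (Nat.le_of_succ_le h) \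
      cut x (remaining x c L k (Nat.le_of_succ_le h)) (c ⟨k, h⟩) (L ⟨k, Nat.lt_succ_of_lt h⟩)

/-- The QuantTree partition of `ℝ^d` into `K = n + 1` bins, built on the training set `x` with `L j`
training points prescribed for bin `j`. The choices `c k` of a component and of a side are the random
draws of the algorithm; the last bin consists of everything that the `n` cuts have left over. -/
def bin {d N n : ℕ} (x : Fin N → Fin d → ℝ) (c : Fin n → Fin d × Bool)
    (L : Fin (n + 1) → ℕ) (j : Fin (n + 1)) : Set (Fin d → ℝ) :=
  if h : (j : ℕ) < n then
    cut x (remaining x c L j h.le) (c ⟨j, h⟩) (L j)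
  else
    remaining x c L n le_rfl

/-- The parameters `(π_1 N, …, π_{K-1} N, π_K N + 1)`, for `K = n + 1`. -/
def dirichletParam {n : ℕ} (π : Fin (n + 1) → ℝ) (N : ℕ) (j : Fin (n + 1)) : ℝ :=
  if j = Fin.last n then π j * N + 1 else π j * N

end QuantTree

end

open scoped ENNReal

noncomputable section

namespace QuantTree

/-! For one cut, the distribution function of an atomless law turns the sample into uniform points.
These leave `N + 1` exchangeable spacings; a bin takes `L j` of them and the last bin one more,
hence the extra `1` in the last parameter. For several cuts, the points beyond the first cut are,
given that cut, again a sample from the distribution restricted to what is left.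

To avoid conditional laws, everything is stated for the unnormalised measure `μ.restrict R` and
proved by induction on the number of cuts (`lintegral_rankBin`). Decompose the sample space by the
index `m` of the point through which the first cut passes and the set `A` of the `L 0 - 1` indices
below it. On such an event, the points outside `A ∪ {m}` are a sample from the rest of `R`, handled
by induction through its mass `μ(R) - u` alone. The points of `A` contribute `u ^ (L 0 - 1)`, and as
`x m` varies, the mass `u` of the first bin runs through `(0, μ(R))` with Lebesgue law
(`lintegral_splitEvent`). All these events contribute equally, and their number is the factor in
`simplexConst_succ`; `simplexIntegral_succ` is the same recursion for the Dirichlet density.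

Order statistics are replaced by ranks, which agree with them almost surely and make sense for any
real functions. Changing the sign of a component reduces cuts from above to cuts from below. The
limit law is the same for each fixed choice of cuts, so random independent choices do not alter it.
-/

open Classical in
/-- The points of `R` for which fewer than `l` of the sample points in `R` have a strictly smaller
value of `f`. -/
def rankCut {E ι : Type*} [Fintype ι] (x : ι → E) (R : Set E) (f : E → ℝ) (l : ℕ) : Set E :=
  {y | y ∈ R ∧ (Finset.univ.filter fun m => x m ∈ R ∧ f (x m) < f y).card < l}

/-- What is left of the region `R` after the first `k` of the `n` cuts by ranks. -/
def rankRemaining {E ι : Type*} [Fintype ι] {n : ℕ} (x : ι → E) (R : Set E) (T : Fin n → E → ℝ)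
    (L : Fin (n + 1) → ℕ) : (k : ℕ) → k ≤ n → Set E
  | 0, _ => R
  | k + 1, h =>
    rankRemaining x R T L k (Nat.le_of_succ_le h) \
      rankCut x (rankRemaining x R T L k (Nat.le_of_succ_le h)) (T ⟨k, h⟩)
        (L ⟨k, Nat.lt_succ_of_lt h⟩)

/-- The partition of `R` obtained by successive cuts by the ranks of the functions `T k`. -/
def rankBin {E ι : Type*} [Fintype ι] {n : ℕ} (x : ι → E) (R : Set E) (T : Fin n → E → ℝ)
    (L : Fin (n + 1) → ℕ) (j : Fin (n + 1)) : Set E :=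
  if h : (j : ℕ) < n then
    rankCut x (rankRemaining x R T L j h.le) (T ⟨j, h⟩) (L j)
  else
    rankRemaining x R T L n le_rfl

/-! ### Combinatorics of cuts by ranks -/

section Combinatorics

variable {E ι κ : Type*} [Fintype ι] [Fintype κ] {n : ℕ}

theorem rankRemaining_subset (x : ι → E) (R : Set E) (T : Fin n → E → ℝ) (L : Fin (n + 1) → ℕ)
    (k : ℕ) (h : k ≤ n) : rankRemaining x R T L k h ⊆ R := by
  induction k with
  | zero => exact subset_rfl
  | succ k ih => exact Set.sdiff_subset.trans (ih _)

/-- The definition peels off the last cut; the induction on the number of bins has to peel off the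
first. -/
theorem rankRemaining_succ (x : ι → E) (R : Set E) (T : Fin (n + 1) → E → ℝ)
    (L : Fin (n + 2) → ℕ) (k : ℕ) (h : k + 1 ≤ n + 1) :
    rankRemaining x R T L (k + 1) h =
      rankRemaining x (R \ rankCut x R (T 0) (L 0)) (Fin.tail T) (Fin.tail L) k
        (Nat.le_of_succ_le_succ h) := by
  induction k with
  | zero => rfl
  | succ k ih =>
    rw [rankRemaining, ih (Nat.le_of_succ_le h)]
    rfl

theorem rankBin_of_isEmpty (x : ι → E) (R : Set E) (T : Fin 0 → E → ℝ) (L : Fin 1 → ℕ)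
    (j : Fin 1) : rankBin x R T L j = R := by
  simp [rankBin, rankRemaining]

theorem rankBin_zero (x : ι → E) (R : Set E) (T : Fin (n + 1) → E → ℝ) (L : Fin (n + 2) → ℕ) :
    rankBin x R T L 0 = rankCut x R (T 0) (L 0) := by
  simp [rankBin, rankRemaining]

theorem rankBin_succ (x : ι → E) (R : Set E) (T : Fin (n + 1) → E → ℝ) (L : Fin (n + 2) → ℕ)
    (j : Fin (n + 1)) :
    rankBin x R T L j.succ =
      rankBin x (R \ rankCut x R (T 0) (L 0)) (Fin.tail T) (Fin.tail L) j := by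
  by_cases h : (j : ℕ) < n
  · have h' : (j.succ : ℕ) < n + 1 := by simpa using h
    rw [rankBin, rankBin, dif_pos h, dif_pos h']
    have := rankRemaining_succ x R T L j h'.le
    simp only [Fin.val_succ]
    rw [this]
    rfl
  · have h' : ¬ (j.succ : ℕ) < n + 1 := by simpa using h
    rw [rankBin, rankBin, dif_neg h, dif_neg h']
    exact rankRemaining_succ x R T L n le_rfl

/-- Ranks inside `R` see only the sample points in `R`, so the others may be dropped. This lets the
points used up by the first cut disappear from the later ones. -/
theorem rankCut_comp (e : κ → ι) (he : Function.Injective e) (x : ι → E) (R : Set E)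
    (hR : ∀ m, x m ∈ R → m ∈ Set.range e) (f : E → ℝ) (l : ℕ) :
    rankCut (x ∘ e) R f l = rankCut x R f l := by
  classical
  ext y
  unfold rankCut
  simp only [Set.mem_ofPred_eq]
  have : (Finset.univ.filter fun m => x m ∈ R ∧ f (x m) < f y) =
      (Finset.univ.filter fun m => (x ∘ e) m ∈ R ∧ f ((x ∘ e) m) < f y).image e := by
    ext m
    simp only [Finset.mem_filter, Finset.mem_univ, true_and, Finset.mem_image, Function.comp]
    constructor
    · rintro ⟨h1, h2⟩
      obtain ⟨k, rfl⟩ := hR m h1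
      exact ⟨k, ⟨h1, h2⟩, rfl⟩
    · rintro ⟨k, h, rfl⟩
      exact h
  rw [this, Finset.card_image_of_injective _ he]

theorem rankRemaining_comp (e : κ → ι) (he : Function.Injective e) (x : ι → E) (R : Set E)
    (hR : ∀ m, x m ∈ R → m ∈ Set.range e) (T : Fin n → E → ℝ) (L : Fin (n + 1) → ℕ)
    (k : ℕ) (h : k ≤ n) :
    rankRemaining (x ∘ e) R T L k h = rankRemaining x R T L k h := by
  induction k with
  | zero => rfl
  | succ k ih =>
    rw [rankRemaining, rankRemaining, ih, rankCut_comp e he]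
    exact fun m hm => hR m (rankRemaining_subset _ _ _ _ _ _ hm)

theorem rankBin_comp (e : κ → ι) (he : Function.Injective e) (x : ι → E) (R : Set E)
    (hR : ∀ m, x m ∈ R → m ∈ Set.range e) (T : Fin n → E → ℝ) (L : Fin (n + 1) → ℕ)
    (j : Fin (n + 1)) :
    rankBin (x ∘ e) R T L j = rankBin x R T L j := by
  unfold rankBin
  split_ifs with h
  · rw [rankRemaining_comp e he x R hR, rankCut_comp e he]
    exact fun m hm => hR m (rankRemaining_subset _ _ _ _ _ _ hm)
  · rw [rankRemaining_comp e he x R hR]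

/-- If the sample point `m` has exactly `l - 1` sample points of `R` below it, the cut is the
sublevel set of `f` at that point. -/
theorem rankCut_eq_of_split (x : ι → E) (R : Set E) (f : E → ℝ) (m : ι) (A : Finset ι)
    (hm : m ∉ A) (hR : ∀ j, x j ∈ R) (hA : ∀ j ∈ A, f (x j) < f (x m))
    (hB : ∀ j ∉ A, j ≠ m → f (x m) < f (x j)) :
    rankCut x R f (A.card + 1) = {y | y ∈ R ∧ f y ≤ f (x m)} := by
  classical
  ext y
  simp only [rankCut, Set.mem_ofPred_eq, hR, true_and, Nat.lt_succ_iff]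
  refine and_congr_right fun _ => ⟨fun h => ?_, fun h => ?_⟩
  · by_contra! hlt
    have : insert m A ⊆ Finset.univ.filter fun j => f (x j) < f y := by
      intro j hj
      rcases Finset.mem_insert.1 hj with rfl | hj
      · simpa using hlt
      · simpa using (hA j hj).trans hlt
    have := Finset.card_le_card this
    rw [Finset.card_insert_of_notMem hm] at this
    have h' := this.trans h
    omega
  · refine Finset.card_le_card fun j hj => ?_
    simp only [Finset.mem_filter, Finset.mem_univ, true_and] at hj
    by_contra hjA
    by_cases hjm : j = m
    · subst hjm; linarith
    · have := hB j hjA hjm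
      linarith

end Combinatorics

/-! ### Measurability of the bin masses -/

section Measurability

variable {E ι : Type*} [Fintype ι] [MeasurableSpace E] {n : ℕ}

/-- The region itself depends on the sample, so measurability is carried jointly in the sample and
the point; bin masses are then measures of sections. -/
theorem measurableSet_rankCut {R : (ι → E) → Set E}
    (hR : MeasurableSet {p : (ι → E) × E | p.2 ∈ R p.1}) {f : E → ℝ} (hf : Measurable f) (l : ℕ) :
    MeasurableSet {p : (ι → E) × E | p.2 ∈ rankCut p.1 (R p.1) f l} := by
  classical
  have h1 : ∀ m, MeasurableSet {p : (ι → E) × E | p.1 m ∈ R p.1 ∧ f (p.1 m) < f p.2} := by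
    intro m
    have hg : Measurable fun p : (ι → E) × E => (p.1, p.1 m) := by fun_prop
    have h2 : Measurable fun p : (ι → E) × E => f (p.1 m) := by fun_prop
    have h3 : Measurable fun p : (ι → E) × E => f p.2 := by fun_prop
    exact (hg hR).inter (measurableSet_lt h2 h3)
  have h2 : Measurable fun p : (ι → E) × E =>
      (Finset.univ.filter fun m => p.1 m ∈ R p.1 ∧ f (p.1 m) < f p.2).card := by
    simp only [Finset.card_filter]
    exact Finset.measurable_sum _ fun m _ => Measurable.ite (h1 m) measurable_const measurable_const
  have h3 := hR.inter (h2 (measurableSet_Iio (a := l)))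
  convert h3 using 1
  ext p
  simp [rankCut]

theorem measurableSet_rankRemaining {R : Set E} (hR : MeasurableSet R) {T : Fin n → E → ℝ}
    (hT : ∀ k, Measurable (T k)) (L : Fin (n + 1) → ℕ) (k : ℕ) (h : k ≤ n) :
    MeasurableSet {p : (ι → E) × E | p.2 ∈ rankRemaining p.1 R T L k h} := by
  induction k with
  | zero => exact measurable_snd hR
  | succ k ih =>
    have hk := Nat.le_of_succ_le h
    exact (ih hk).diff (measurableSet_rankCut (R := fun x => rankRemaining x R T L k hk) (ih hk)
      (hT ⟨k, h⟩) (L ⟨k, Nat.lt_succ_of_lt h⟩))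

theorem measurableSet_rankBin {R : Set E} (hR : MeasurableSet R) {T : Fin n → E → ℝ}
    (hT : ∀ k, Measurable (T k)) (L : Fin (n + 1) → ℕ) (j : Fin (n + 1)) :
    MeasurableSet {p : (ι → E) × E | p.2 ∈ rankBin p.1 R T L j} := by
  unfold rankBin
  split_ifs with h
  · exact measurableSet_rankCut (R := fun x => rankRemaining x R T L j h.le)
      (measurableSet_rankRemaining hR hT L _ _) (hT _) _
  · exact measurableSet_rankRemaining hR hT L _ _

theorem measurable_measureReal_rankBin (μ : Measure E) [SFinite μ] {R : Set E}
    (hR : MeasurableSet R) {T : Fin n → E → ℝ} (hT : ∀ k, Measurable (T k))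
    (L : Fin (n + 1) → ℕ) :
    Measurable fun (x : ι → E) j => μ.real (rankBin x R T L j) :=
  measurable_pi_lambda _ fun j =>
    (measurable_measure_prodMk_left (measurableSet_rankBin hR hT L j)).ennreal_toReal

end Measurability

/-! ### Order statistics in terms of counts -/

section OrderStat

/-- In a sorted list the entries below `y` form an initial segment; the count is its length. -/
theorem le_getElem_iff_countP_le {a : List ℝ} (ha : a.Pairwise (· ≤ ·)) {i : ℕ} (hi : i < a.length)
    (y : ℝ) : y ≤ a[i] ↔ a.countP (fun v => decide (v < y)) ≤ i := by
  have hmono : ∀ (j k : ℕ) (hjk : j ≤ k) (hk : k < a.length), a[j] ≤ a[k] := fun j k hjk hk =>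
    ha.rel_get_of_le (a := ⟨j, hjk.trans_lt hk⟩) (b := ⟨k, hk⟩) hjk
  constructor
  · intro h
    rw [← List.take_append_drop i a, List.countP_append]
    have h2 : (a.drop i).countP (fun v => decide (v < y)) = 0 := by
      rw [List.countP_eq_zero]
      intro v hv
      obtain ⟨k, hk, rfl⟩ := List.mem_iff_getElem.1 hv
      rw [List.getElem_drop]
      have := hmono i (i + k) (by omega) (by simp at hk; omega)
      simpa using h.trans this
    rw [h2]
    exact (List.countP_le_length).trans (by simp)
  · intro h
    by_contra! hlt
    have h1 : (a.take (i + 1)).countP (fun v => decide (v < y)) = (a.take (i + 1)).length := by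
      rw [List.countP_eq_length]
      intro v hv
      obtain ⟨k, hk, rfl⟩ := List.mem_iff_getElem.1 hv
      rw [List.getElem_take]
      have := hmono k i (by simp at hk; omega) hi
      simpa using this.trans_lt hlt
    have h2 := (List.take_sublist (i + 1) a).countP_le (p := fun v => decide (v < y))
    rw [h1, List.length_take] at h2
    omega

theorem getElem_le_iff_countP_lt {a : List ℝ} (ha : a.Pairwise (· ≤ ·)) {i : ℕ} (hi : i < a.length)
    (y : ℝ) : a[i] ≤ y ↔ a.countP (fun v => decide (y < v)) < a.length - i := by
  have hmono : ∀ (j k : ℕ) (hjk : j ≤ k) (hk : k < a.length), a[j] ≤ a[k] := fun j k hjk hk =>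
    ha.rel_get_of_le (a := ⟨j, hjk.trans_lt hk⟩) (b := ⟨k, hk⟩) hjk
  constructor
  · intro h
    rw [← List.take_append_drop (i + 1) a, List.countP_append]
    have h2 : (a.take (i + 1)).countP (fun v => decide (y < v)) = 0 := by
      rw [List.countP_eq_zero]
      intro v hv
      obtain ⟨k, hk, rfl⟩ := List.mem_iff_getElem.1 hv
      rw [List.getElem_take]
      have := hmono k i (by simp at hk; omega) hi
      simpa using this.trans h
    rw [h2, zero_add, List.take_append_drop]
    exact (List.countP_le_length).trans_lt (by simp; omega)
  · intro h
    by_contra! hlt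
    have h1 : (a.drop i).countP (fun v => decide (y < v)) = (a.drop i).length := by
      rw [List.countP_eq_length]
      intro v hv
      obtain ⟨k, hk, rfl⟩ := List.mem_iff_getElem.1 hv
      rw [List.getElem_drop]
      have := hmono i (i + k) (by omega) (by simp at hk; omega)
      simpa using hlt.trans_le this
    have h2 := (List.drop_sublist i a).countP_le (p := fun v => decide (y < v))
    rw [h1, List.length_drop] at h2
    omega

theorem le_orderStat_iff (s : Multiset ℝ) {l : ℕ} (hl : 0 < l) (hs : l ≤ s.card) (y : ℝ) :
    y ≤ orderStat s l ↔ s.countP (· < y) < l := by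
  -- With `0 < l ≤ s.card` the index is in range and the default value `0` is never read.
  have hlen : l - 1 < (s.sort (· ≤ ·)).length := by simp; omega
  rw [orderStat, List.getD_eq_getElem _ _ hlen,
    le_getElem_iff_countP_le (s.pairwise_sort (· ≤ ·)) hlen]
  conv_rhs => rw [← Multiset.sort_eq s (· ≤ ·), Multiset.coe_countP]
  omega

theorem orderStat_le_iff (s : Multiset ℝ) {l : ℕ} (hl : 0 < l) (hs : l ≤ s.card) (y : ℝ) :
    orderStat s (s.card - l + 1) ≤ y ↔ s.countP (y < ·) < l := by
  have hlen : s.card - l + 1 - 1 < (s.sort (· ≤ ·)).length := by simp; omega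
  rw [orderStat, List.getD_eq_getElem _ _ hlen,
    getElem_le_iff_countP_lt (s.pairwise_sort (· ≤ ·)) hlen]
  conv_rhs => rw [← Multiset.sort_eq s (· ≤ ·), Multiset.coe_countP]
  have : (s.sort (· ≤ ·)).length = s.card := by simp
  rw [this]
  omega

end OrderStat

/-! ### QuantTree bins as bins cut by ranks -/

/-- The signed component by which the choice `c` of a component and of a side cuts from below. -/
def signedComponent {d : ℕ} (c : Fin d × Bool) (y : Fin d → ℝ) : ℝ :=
  if c.2 then -y c.1 else y c.1

theorem measurable_signedComponent {d : ℕ} (c : Fin d × Bool) : Measurable (signedComponent c) := by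
  unfold signedComponent
  split_ifs <;> fun_prop

open Classical in
theorem cut_eq_rankCut {d N : ℕ} (x : Fin N → Fin d → ℝ) (R : Set (Fin d → ℝ)) (c : Fin d × Bool)
    {l : ℕ} (hl : 0 < l) (hR : l ≤ (Finset.univ.filter fun m => x m ∈ R).card) :
    cut x R c l = rankCut x R (signedComponent c) l := by
  have hcard : ∀ i, (componentsIn x R i).card = (Finset.univ.filter fun m => x m ∈ R).card := by
    intro i
    rw [componentsIn, Multiset.card_map]
    rfl
  obtain ⟨i, b⟩ := c
  ext y
  cases b
  · simp only [cut, rankCut, Set.mem_ofPred_eq]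
    refine and_congr_right fun _ => ?_
    rw [le_orderStat_iff _ hl (by rw [hcard]; exact hR), componentsIn, Multiset.countP_map,
      ← Finset.filter_val, Finset.filter_filter]
    simp only [signedComponent, if_false, Bool.false_eq_true]
    exact Iff.rfl
  · simp only [cut, rankCut, Set.mem_ofPred_eq]
    refine and_congr_right fun _ => ?_
    rw [orderStat_le_iff _ hl (by rw [hcard]; exact hR), componentsIn, Multiset.countP_map,
      ← Finset.filter_val, Finset.filter_filter]
    simp only [signedComponent, if_true, neg_lt_neg_iff]
    exact Iff.rfl

open Classical in
/-- Without ties, a cut at level `l` removes at most `l` sample points. -/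
theorem card_filter_le_card_filter_diff_rankCut {E ι : Type*} [Fintype ι] (x : ι → E) (R : Set E)
    {f : E → ℝ} (hf : Function.Injective (f ∘ x)) (l : ℕ) :
    (Finset.univ.filter fun m => x m ∈ R).card ≤
      l + (Finset.univ.filter fun m => x m ∈ R \ rankCut x R f l).card := by
  have hsplit := Finset.card_filter_add_card_filter_not (s := Finset.univ.filter fun m => x m ∈ R)
    (p := fun m => x m ∈ rankCut x R f l)
  rw [Finset.filter_filter, Finset.filter_filter] at hsplit
  have h1 : (Finset.univ.filter fun m => x m ∈ R ∧ x m ∈ rankCut x R f l).card ≤ l := by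
    rcases (Finset.univ.filter fun m => x m ∈ R ∧ x m ∈ rankCut x R f l).eq_empty_or_nonempty with
      h | h
    · simp [h]
    -- The removed point with the largest value has fewer than `l` points below it, and without ties
    -- every other removed point is one of these.
    · obtain ⟨m, hm, hmax⟩ := Finset.exists_max_image _ (f ∘ x) h
      have hml : (Finset.univ.filter fun j => x j ∈ R ∧ f (x j) < f (x m)).card < l := by
        have := (Finset.mem_filter.1 hm).2.2
        exact this.2
      have : (Finset.univ.filter fun m => x m ∈ R ∧ x m ∈ rankCut x R f l) ⊆
          insert m (Finset.univ.filter fun j => x j ∈ R ∧ f (x j) < f (x m)) := by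
        intro j hj
        by_cases hjm : j = m
        · simp [hjm]
        · refine Finset.mem_insert_of_mem ?_
          have h1 := hmax j hj
          have h2 : f (x j) ≠ f (x m) := fun h => hjm (hf h)
          simp only [Finset.mem_filter, Finset.mem_univ, true_and] at hj ⊢
          exact ⟨hj.1, lt_of_le_of_ne h1 h2⟩
      have := (Finset.card_le_card this).trans (Finset.card_insert_le _ _)
      omega
  have h2 : (Finset.univ.filter fun m => x m ∈ R \ rankCut x R f l) =
      (Finset.univ.filter fun m => x m ∈ R ∧ ¬ x m ∈ rankCut x R f l) := by
    ext m; simp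
  rw [h2]
  omega

-- Both claims need each other: enough points must be left for the next order statistic to exist,
-- and this count rests on the earlier cuts being cuts by ranks.
open Classical in
theorem remaining_eq_rankRemaining {d N n : ℕ} (x : Fin N → Fin d → ℝ) (c : Fin n → Fin d × Bool)
    (L : Fin (n + 1) → ℕ) (hL : ∀ j, 0 < L j) (hN : ∑ j, L j = N)
    (hx : ∀ k, Function.Injective (signedComponent (c k) ∘ x)) (k : ℕ) (h : k ≤ n) :
    remaining x c L k h = rankRemaining x Set.univ (fun k => signedComponent (c k)) L k h ∧
      ∑ j ∈ Finset.univ.filter (fun j : Fin (n + 1) => k ≤ (j : ℕ)), L j ≤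
        (Finset.univ.filter fun m => x m ∈ remaining x c L k h).card := by
  induction k with
  | zero => simp [remaining, rankRemaining, hN]
  | succ k ih =>
    obtain ⟨h1, h2⟩ := ih (Nat.le_of_succ_le h)
    have hs : (Finset.univ.filter fun j : Fin (n + 1) => k ≤ (j : ℕ)) =
        insert ⟨k, Nat.lt_succ_of_lt h⟩
          (Finset.univ.filter fun j : Fin (n + 1) => k + 1 ≤ (j : ℕ)) := by
      ext j
      simp only [Finset.mem_filter, Finset.mem_univ, true_and, Finset.mem_insert, Fin.ext_iff]
      omega
    rw [hs, Finset.sum_insert (by simp)] at h2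
    have hcut := cut_eq_rankCut x (remaining x c L k (Nat.le_of_succ_le h)) (c ⟨k, h⟩)
      (hL ⟨k, Nat.lt_succ_of_lt h⟩) (by omega)
    have hcount := card_filter_le_card_filter_diff_rankCut x
      (remaining x c L k (Nat.le_of_succ_le h)) (hx ⟨k, h⟩) (L ⟨k, Nat.lt_succ_of_lt h⟩)
    rw [remaining, rankRemaining, hcut, ← h1]
    refine ⟨rfl, ?_⟩
    have := Nat.le_of_add_le_add_left (h2.trans hcount)
    convert this

theorem bin_eq_rankBin {d N n : ℕ} (x : Fin N → Fin d → ℝ) (c : Fin n → Fin d × Bool)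
    (L : Fin (n + 1) → ℕ) (hL : ∀ j, 0 < L j) (hN : ∑ j, L j = N)
    (hx : ∀ k, Function.Injective (signedComponent (c k) ∘ x)) (j : Fin (n + 1)) :
    bin x c L j = rankBin x Set.univ (fun k => signedComponent (c k)) L j := by
  classical
  unfold bin rankBin
  split_ifs with h
  · obtain ⟨h1, h2⟩ := remaining_eq_rankRemaining x c L hL hN hx j h.le
    rw [cut_eq_rankCut _ _ _ (hL j), h1]
    exact (Finset.single_le_sum (f := L) (fun _ _ => Nat.zero_le _) (by simp)).trans h2
  · exact (remaining_eq_rankRemaining x c L hL hN hx n le_rfl).1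

/-! ### Dirichlet integrals on simplices -/

open Classical in
/-- The unnormalised Dirichlet density with integer parameters `L 0, …, L (n-1), L n + 1` on the
simplex of size `M`. -/
def simplexWeight {n : ℕ} (L : Fin (n + 1) → ℕ) (M : ℝ) (x : Fin n → ℝ) : ℝ≥0∞ :=
  if (∀ i, 0 < x i) ∧ ∑ i, x i < M then
    (∏ i, ENNReal.ofReal (x i) ^ (L i.castSucc - 1)) *
      ENNReal.ofReal (M - ∑ i, x i) ^ L (Fin.last n)
  else 0

/-- The integral of `g` against the unnormalised Dirichlet density on the simplex of size `M`. -/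
def simplexIntegral {n : ℕ} (L : Fin (n + 1) → ℕ) (M : ℝ) (g : (Fin (n + 1) → ℝ) → ℝ≥0∞) : ℝ≥0∞ :=
  ∫⁻ x : Fin n → ℝ, simplexWeight L M x * g (Fin.snoc (α := fun _ => ℝ) x (M - ∑ i, x i))

/-- The normalising constant of the Dirichlet distribution with parameters
`L 0, …, L (n-1), L n + 1`. -/
def simplexConst {n : ℕ} (L : Fin (n + 1) → ℕ) : ℝ :=
  (∑ j, L j).factorial / ((∏ i : Fin n, (L i.castSucc - 1).factorial) * (L (Fin.last n)).factorial)

theorem measurable_simplexWeight {n : ℕ} (L : Fin (n + 1) → ℕ) :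
    Measurable fun p : ℝ × (Fin n → ℝ) => simplexWeight L p.1 p.2 := by
  unfold simplexWeight
  refine Measurable.ite ?_ (by fun_prop) measurable_const
  refine MeasurableSet.inter (s₁ := {p : ℝ × (Fin n → ℝ) | ∀ i, 0 < p.2 i}) ?_ ?_
  · have : {p : ℝ × (Fin n → ℝ) | ∀ i, 0 < p.2 i} = ⋂ i, {p | 0 < p.2 i} := by ext; simp
    rw [this]
    exact MeasurableSet.iInter fun i => measurableSet_lt (by fun_prop) (by fun_prop)
  · exact measurableSet_lt (f := fun p : ℝ × (Fin n → ℝ) => ∑ i, p.2 i) (g := fun p => p.1)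
      (by fun_prop) (by fun_prop)

theorem simplexWeight_cons {n : ℕ} (L : Fin (n + 2) → ℕ) (M u : ℝ) (x : Fin n → ℝ) :
    simplexWeight L M (Fin.cons u x : Fin (n + 1) → ℝ) =
      (Set.Ioo 0 M).indicator (fun u => ENNReal.ofReal u ^ (L 0 - 1)) u *
        simplexWeight (Fin.tail L) (M - u) x := by
  classical
  have hiff : ((∀ i, 0 < (Fin.cons u x : Fin (n + 1) → ℝ) i) ∧
      ∑ i, (Fin.cons u x : Fin (n + 1) → ℝ) i < M) ↔
      (u ∈ Set.Ioo 0 M ∧ (∀ i, 0 < x i) ∧ ∑ i, x i < M - u) := by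
    simp only [Fin.forall_fin_succ, Fin.cons_zero, Fin.cons_succ, Fin.sum_univ_succ, Set.mem_Ioo]
    constructor
    · rintro ⟨⟨h1, h2⟩, h3⟩
      have := Finset.sum_nonneg fun i (_ : i ∈ Finset.univ) => (h2 i).le
      exact ⟨⟨h1, by linarith⟩, h2, by linarith⟩
    · rintro ⟨⟨h1, _⟩, h2, h3⟩
      exact ⟨⟨h1, h2⟩, by linarith⟩
  unfold simplexWeight
  by_cases hu : u ∈ Set.Ioo 0 M
  · by_cases hx : (∀ i, 0 < x i) ∧ ∑ i, x i < M - u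
    · rw [if_pos (hiff.2 ⟨hu, hx⟩), if_pos hx, Set.indicator_of_mem hu, Fin.prod_univ_succ,
        Fin.sum_univ_succ]
      simp only [Fin.cons_zero, Fin.cons_succ, Fin.tail, Fin.castSucc_zero, Fin.succ_castSucc,
        Fin.succ_last, sub_sub, mul_assoc]
    · rw [if_neg (fun h => hx (hiff.1 h).2), if_neg hx, mul_zero]
  · rw [if_neg (fun h => hu (hiff.1 h).1), Set.indicator_of_notMem hu, zero_mul]

theorem measurable_simplexIntegral_cons {n : ℕ} (L : Fin (n + 1) → ℕ) (M : ℝ)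
    {g : (Fin (n + 2) → ℝ) → ℝ≥0∞} (hg : Measurable g) :
    Measurable fun u : ℝ => simplexIntegral L (M - u)
      fun q => g (Fin.cons (α := fun _ => ℝ) u q) := by
  unfold simplexIntegral
  refine Measurable.lintegral_prod_right' (f := fun p : ℝ × (Fin n → ℝ) =>
    simplexWeight L (M - p.1) p.2 * g (Fin.cons (α := fun _ => ℝ) p.1
      (Fin.snoc (α := fun _ => ℝ) p.2 (M - p.1 - ∑ i, p.2 i)))) ?_
  refine Measurable.mul ?_ (hg.comp ?_)
  · exact (measurable_simplexWeight L).comp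
      (f := fun p : ℝ × (Fin n → ℝ) => (M - p.1, p.2)) (by fun_prop)
  · refine measurable_pi_lambda _ fun j => ?_
    refine Fin.cases ?_ (fun j => ?_) j
    · simp only [Fin.cons_zero]; fun_prop
    · simp only [Fin.cons_succ]
      refine Fin.lastCases ?_ (fun i => ?_) j
      · simp only [Fin.snoc_last]; fun_prop
      · simp only [Fin.snoc_castSucc]; fun_prop

theorem measurable_snoc_sub {n : ℕ} (M : ℝ) :
    Measurable fun x : Fin n → ℝ => (Fin.snoc (α := fun _ => ℝ) x (M - ∑ i, x i)) := by
  refine measurable_pi_lambda _ fun j => ?_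
  refine Fin.lastCases ?_ (fun i => ?_) j
  · simp only [Fin.snoc_last]; fun_prop
  · simp only [Fin.snoc_castSucc]; fun_prop

/-- Tonelli in the first coordinate: fixing it at `u` leaves a simplex of size `M - u`. -/
theorem simplexIntegral_succ {n : ℕ} (L : Fin (n + 2) → ℕ) (M : ℝ)
    {g : (Fin (n + 2) → ℝ) → ℝ≥0∞} (hg : Measurable g) :
    simplexIntegral L M g = ∫⁻ u in Set.Ioo 0 M, ENNReal.ofReal u ^ (L 0 - 1) *
      simplexIntegral (Fin.tail L) (M - u) fun q => g (Fin.cons (α := fun _ => ℝ) u q) := by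
  have hmeas : Measurable fun x : Fin (n + 1) → ℝ =>
      simplexWeight L M x * g (Fin.snoc (α := fun _ => ℝ) x (M - ∑ i, x i)) :=
    ((measurable_simplexWeight L).comp (measurable_const.prodMk measurable_id)).mul
      (hg.comp (measurable_snoc_sub M))
  have hmp := (volume_preserving_piFinSuccAbove (fun _ : Fin (n + 1) => ℝ) 0).symm
  rw [simplexIntegral, ← hmp.lintegral_comp hmeas, Measure.volume_eq_prod]
  refine (lintegral_prod _ (hmeas.comp hmp.measurable).aemeasurable).trans ?_
  rw [← lintegral_indicator measurableSet_Ioo]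
  refine lintegral_congr fun u => ?_
  have hcons : ∀ x : Fin n → ℝ, (MeasurableEquiv.piFinSuccAbove (fun _ : Fin (n + 1) => ℝ) 0).symm
      (u, x) = (Fin.cons u x : Fin (n + 1) → ℝ) := by
    intro x
    simp [MeasurableEquiv.piFinSuccAbove, Fin.consEquiv]
  simp only [Function.comp_apply, hcons, simplexWeight_cons, mul_assoc]
  have hsnoc : ∀ x : Fin n → ℝ, (Fin.snoc (α := fun _ => ℝ) (Fin.cons u x : Fin (n + 1) → ℝ)
      (M - ∑ i, (Fin.cons u x : Fin (n + 1) → ℝ) i) : Fin (n + 2) → ℝ) =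
      Fin.cons (α := fun _ => ℝ) u (Fin.snoc (α := fun _ => ℝ) x (M - u - ∑ i, x i)) := by
    intro x
    rw [Fin.cons_snoc_eq_snoc_cons, Fin.sum_univ_succ, sub_sub]
    simp
  simp only [hsnoc]
  rw [lintegral_const_mul]
  · by_cases hu : u ∈ Set.Ioo 0 M
    · simp only [Set.indicator_of_mem hu, simplexIntegral]
    · simp only [Set.indicator_of_notMem hu, zero_mul]
  · refine ((measurable_simplexWeight _).comp (measurable_const.prodMk measurable_id)).mul
      (hg.comp ?_)
    simp only [← hsnoc]
    have hc : Measurable fun x : Fin n → ℝ => (Fin.cons u x : Fin (n + 1) → ℝ) := by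
      refine measurable_pi_lambda _ fun j => ?_
      refine Fin.cases ?_ (fun j => ?_) j
      · simp only [Fin.cons_zero]; fun_prop
      · simp only [Fin.cons_succ]; fun_prop
    exact (measurable_snoc_sub M).comp hc

theorem simplexIntegral_zero (L : Fin 1 → ℕ) {M : ℝ} (hL : 0 < L 0) (hM : 0 ≤ M)
    (g : (Fin 1 → ℝ) → ℝ≥0∞) :
    simplexIntegral L M g = ENNReal.ofReal M ^ L 0 * g fun _ => M := by
  have hw (x : Fin 0 → ℝ) : simplexWeight L M x = ENNReal.ofReal M ^ L 0 := by
    rw [simplexWeight]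
    -- At `M = 0` the strict inequality makes the weight vanish; the power vanishes too because `0 <
    -- L 0`.
    rcases hM.eq_or_lt with rfl | hM
    · simp [hL.ne']
    · simp [hM]
  have hvol : (volume : Measure (Fin 0 → ℝ)) Set.univ = 1 := by
    rw [volume_pi, Measure.pi_of_empty]
    simp
  rw [simplexIntegral, lintegral_unique, hvol, mul_one, hw]
  congr 2
  funext j
  obtain rfl : j = Fin.last 0 := Subsingleton.elim (α := Fin 1) _ _
  rw [Fin.snoc_last]
  simp

/-- The factor counts the pairs `(m, A)`: the point on the first cut, and the `L 0 - 1` points below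
it. -/
theorem simplexConst_succ {n : ℕ} (L : Fin (n + 2) → ℕ) (hL : 0 < L 0) :
    simplexConst L = ((∑ j, L j) * ((∑ j, L j) - 1).choose (L 0 - 1) : ℕ) *
      simplexConst (Fin.tail L) := by
  obtain ⟨l, hl⟩ : ∃ l, L 0 = l + 1 := ⟨L 0 - 1, by omega⟩
  set S := ∑ j, Fin.tail L j with hS
  have hsum : ∑ j, L j = l + S + 1 := by
    rw [Fin.sum_univ_succ, hl, hS]
    simp only [Fin.tail]
    ring
  have hch := Nat.add_choose_mul_factorial_mul_factorial l S
  have hlast : L (Fin.last (n + 1)) = Fin.tail L (Fin.last n) := by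
    rw [Fin.tail, Fin.succ_last]
  have hprod : ∏ i : Fin (n + 1), (L i.castSucc - 1).factorial =
      l.factorial * ∏ i : Fin n, (Fin.tail L i.castSucc - 1).factorial := by
    rw [Fin.prod_univ_succ, Fin.castSucc_zero, hl]
    rfl
  unfold simplexConst
  have hfac : (l + S + 1).factorial =
      (l + S + 1) * (l + S).choose l * (l.factorial * S.factorial) := by
    rw [Nat.factorial_succ, ← hch, Nat.choose_symm_add]
    ring
  rw [hprod, hlast, hsum, ← hS, hl, hfac]
  simp only [Nat.add_sub_cancel]
  have h1 : (l.factorial : ℝ) ≠ 0 := by positivity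
  push_cast
  field_simp

/-! ### The distribution function of an atomless measure -/

theorem continuous_measureReal_Iic (ρ : Measure ℝ) [IsFiniteMeasure ρ] [NullSingletonClass ρ] :
    Continuous fun t => ρ.real (Set.Iic t) := by
  have h : (fun t => ρ.real (Set.Iic t)) =
      fun t => ρ.real (Set.Iic 0) + ∫ _ in (0 : ℝ)..t, (1 : ℝ) ∂ρ := by
    funext t
    rw [← intervalIntegral.integral_Iic_sub_Iic (integrable_const _).integrableOn
      (integrable_const _).integrableOn]
    simp
  rw [h]
  exact continuous_const.add
    (intervalIntegral.continuous_primitive (fun _ _ => intervalIntegrable_const) _)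

/-- A finite atomless measure on `ℝ` is mapped to Lebesgue measure on an interval by its
distribution function. -/
theorem map_measureReal_Iic (ρ : Measure ℝ) [IsFiniteMeasure ρ] [NullSingletonClass ρ] :
    ρ.map (fun t => ρ.real (Set.Iic t)) = volume.restrict (Set.Ioo 0 (ρ.real Set.univ)) := by
  set F : ℝ → ℝ := fun t => ρ.real (Set.Iic t) with hF
  set M := ρ.real Set.univ with hM
  have hcont : Continuous F := continuous_measureReal_Iic ρ
  have hmono : Monotone F := fun a b hab => measureReal_mono (Set.Iic_subset_Iic.2 hab)
  have hle : ∀ t, F t ≤ M := fun t => measureReal_mono (Set.subset_univ _)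
  have htop : Filter.Tendsto F Filter.atTop (nhds M) :=
    (ENNReal.tendsto_toReal (measure_ne_top ρ _)).comp (tendsto_measure_Iic_atTop ρ)
  have hbot : Filter.Tendsto F Filter.atBot (nhds 0) := by
    have h := tendsto_measure_iInter_atBot (μ := ρ) (s := fun t : ℝ => Set.Iic t)
      (fun _ => measurableSet_Iic.nullMeasurableSet) (fun _ _ h => Set.Iic_subset_Iic.2 h)
      ⟨0, measure_ne_top _ _⟩
    have hempty : ⋂ t : ℝ, Set.Iic t = ∅ :=
      Set.eq_empty_of_forall_notMem fun t ht =>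
        absurd (Set.mem_iInter.1 ht (t - 1)) (by simp)
    rw [hempty, measure_empty] at h
    exact (ENNReal.tendsto_toReal ENNReal.zero_ne_top).comp h
  refine Measure.ext_of_Iic _ _ fun u => ?_
  rw [Measure.map_apply hcont.measurable measurableSet_Iic, Measure.restrict_apply measurableSet_Iic]
  rcases lt_or_ge u 0 with hu | hu
  · have h1 : F ⁻¹' Set.Iic u = ∅ := by
      ext t
      simpa using hu.trans_le measureReal_nonneg
    have h2 : Set.Iic u ∩ Set.Ioo 0 M = ∅ := by
      ext t
      simp only [Set.mem_inter_iff, Set.mem_Iic, Set.mem_Ioo, Set.mem_empty_iff_false, iff_false]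
      intro h
      linarith [h.1, h.2.1]
    simp [h1, h2]
  rcases le_or_gt M u with hMu | hMu
  · have h1 : F ⁻¹' Set.Iic u = Set.univ := Set.eq_univ_of_forall fun t => (hle t).trans hMu
    have h2 : Set.Iic u ∩ Set.Ioo 0 M = Set.Ioo 0 M :=
      Set.inter_eq_right.2 fun t ht => ht.2.le.trans hMu
    rw [h1, h2, Real.volume_Ioo, sub_zero, hM, ofReal_measureReal]
  · have h2 : Set.Iic u ∩ Set.Ioo 0 M = Set.Ioc 0 u := by
      ext t
      simp only [Set.mem_inter_iff, Set.mem_Iic, Set.mem_Ioo, Set.mem_Ioc]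
      exact ⟨fun h => ⟨h.2.1, h.1⟩, fun h => ⟨h.2, h.1, h.2.trans_lt hMu⟩⟩
    rw [h2, Real.volume_Ioc, sub_zero]
    rcases (F ⁻¹' Set.Iic u).eq_empty_or_nonempty with hS | hS
    · have hu0 : u ≤ 0 := by
        refine le_of_tendsto_of_tendsto' tendsto_const_nhds hbot fun t => ?_
        by_contra! h
        have : t ∈ F ⁻¹' Set.Iic u := h.le
        simp [hS] at this
      simp [hS, hu0]
    -- The sublevel set is closed and bounded above, hence `Iic s` with `s` its supremum. As `F > u`
    -- to the right of `s`, continuity gives `F s = u`.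
    · obtain ⟨b, hb⟩ := (htop.eventually (lt_mem_nhds hMu)).exists
      have hbdd : BddAbove (F ⁻¹' Set.Iic u) := by
        refine ⟨b, fun t ht => ?_⟩
        by_contra! h
        have h3 : F t ≤ u := ht
        linarith [hmono h.le]
      have hmem := (isClosed_Iic.preimage hcont).csSup_mem hS hbdd
      set s := sSup (F ⁻¹' Set.Iic u) with hs
      have hSs : F ⁻¹' Set.Iic u = Set.Iic s :=
        Set.Subset.antisymm (fun t ht => le_csSup hbdd ht) fun t ht =>
          (hmono ht).trans hmem
      have hFs : F s = u := by
        refine le_antisymm hmem ?_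
        have : Filter.Tendsto F (nhdsWithin s (Set.Ioi s)) (nhds (F s)) :=
          hcont.continuousAt.tendsto.mono_left nhdsWithin_le_nhds
        refine ge_of_tendsto this ?_
        filter_upwards [self_mem_nhdsWithin] with t ht
        by_contra! h
        exact absurd (le_csSup hbdd (show t ∈ F ⁻¹' Set.Iic u from h.le)) (not_le.2 ht)
      rw [hSs, ← hFs, hF, ofReal_measureReal]

/-! ### Integration over independent samples -/

section Product

variable {E ι : Type*} [Fintype ι] [MeasurableSpace E]

theorem lintegral_pi_eq_lintegral_lintegral (ν : Measure E) [SigmaFinite ν] (p : ι → Prop)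
    [DecidablePred p] {h : (ι → E) → ℝ≥0∞} (hh : Measurable h) :
    ∫⁻ x, h x ∂Measure.pi (fun _ => ν) =
      ∫⁻ a : {j // p j} → E, ∫⁻ b : {j // ¬ p j} → E,
        h (fun j => if hj : p j then a ⟨j, hj⟩ else b ⟨j, hj⟩)
          ∂Measure.pi (fun _ => ν) ∂Measure.pi (fun _ => ν) := by
  have hmp := (measurePreserving_piEquivPiSubtypeProd (fun _ : ι => ν) p).symm
  rw [← hmp.lintegral_comp hh]
  exact lintegral_prod _ (hh.comp hmp.measurable).aemeasurable

/-- With all points but `x j` frozen, a tie forces `f (x j)` to take a prescribed value, a null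
event. -/
theorem ae_injective_comp (ν : Measure E) [SigmaFinite ν] {f : E → ℝ} (hf : Measurable f)
    (hν : ∀ t, ν {y | f y = t} = 0) :
    ∀ᵐ x ∂Measure.pi (fun _ : ι => ν), Function.Injective (f ∘ x) := by
  classical
  have key : ∀ i j : ι, i ≠ j → ∀ᵐ x ∂Measure.pi (fun _ : ι => ν), f (x i) ≠ f (x j) := by
    intro i j hij
    have hm : MeasurableSet {x : ι → E | f (x i) = f (x j)} :=
      measurableSet_eq_fun (by fun_prop) (by fun_prop)
    rw [ae_iff]
    simp only [ne_eq, not_not]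
    rw [← lintegral_indicator_one hm, lintegral_pi_eq_lintegral_lintegral ν (fun k => k ≠ j)
      (measurable_one.indicator hm)]
    refine (lintegral_congr fun a => ?_).trans lintegral_zero
    have hnull : Measure.pi (fun _ : {k // ¬ k ≠ j} => ν)
        (Function.eval ⟨j, by simp⟩ ⁻¹' {y | f y = f (a ⟨i, hij⟩)}) = 0 :=
      Measure.pi_eval_preimage_null _ (hν _)
    refine (lintegral_congr_ae ?_).trans lintegral_zero
    filter_upwards [measure_eq_zero_iff_ae_notMem.1 hnull] with b hb
    refine Set.indicator_of_notMem ?_ _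
    simpa [hij, eq_comm] using hb
  filter_upwards [ae_all_iff.2 fun i => ae_all_iff.2 fun j => ae_all_iff.2 (key i j)] with x hx
  intro i j hij
  by_contra h
  exact hx i j h hij

/-- Once `a m = y` is fixed, each of the other points falls independently in `{f < f y}`. -/
theorem lintegral_pi_of_max (ν : Measure E) [SigmaFinite ν] {f : E → ℝ} (hf : Measurable f) (m : ι)
    {H : E → ℝ≥0∞} (hH : Measurable H) :
    ∫⁻ a, {a : ι → E | ∀ j, j ≠ m → f (a j) < f (a m)}.indicator (fun a => H (a m)) a
        ∂Measure.pi (fun _ => ν) =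
      ∫⁻ y, H y * ν {z | f z < f y} ^ (Fintype.card ι - 1) ∂ν := by
  classical
  have hS : MeasurableSet {a : ι → E | ∀ j, j ≠ m → f (a j) < f (a m)} := by
    have : {a : ι → E | ∀ j, j ≠ m → f (a j) < f (a m)} =
        ⋂ j, ⋂ (_ : j ≠ m), {a | f (a j) < f (a m)} := by ext; simp
    rw [this]
    exact MeasurableSet.iInter fun j => MeasurableSet.iInter fun _ =>
      measurableSet_lt (by fun_prop) (by fun_prop)
  have hHm : Measurable fun a : ι → E => H (a m) := hH.comp (measurable_pi_apply m)
  rw [lintegral_pi_eq_lintegral_lintegral ν (fun k => k = m) (hHm.indicator hS)]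
  have hinner : ∀ a : {j // j = m} → E, ∫⁻ b : {j // ¬ j = m} → E,
      {a : ι → E | ∀ j, j ≠ m → f (a j) < f (a m)}.indicator (fun a => H (a m))
        (fun j => if hj : j = m then a ⟨j, hj⟩ else b ⟨j, hj⟩) ∂Measure.pi (fun _ => ν) =
      H (a default) * ν {z | f z < f (a default)} ^ (Fintype.card ι - 1) := by
    intro a
    have hU : MeasurableSet (Set.univ.pi fun _ : {j // ¬ j = m} => {z | f z < f (a default)}) :=
      MeasurableSet.univ_pi fun _ => measurableSet_lt hf measurable_const
    have : ∀ b : {j // ¬ j = m} → E,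
        {a : ι → E | ∀ j, j ≠ m → f (a j) < f (a m)}.indicator (fun a => H (a m))
          (fun j => if hj : j = m then a ⟨j, hj⟩ else b ⟨j, hj⟩) =
        (Set.univ.pi fun _ : {j // ¬ j = m} => {z | f z < f (a default)}).indicator
          (fun _ => H (a default)) b := by
      intro b
      have ha : a ⟨m, rfl⟩ = a default := rfl
      by_cases hb : b ∈ Set.univ.pi fun _ : {j // ¬ j = m} => {z | f z < f (a default)}
      · rw [Set.indicator_of_mem hb, Set.indicator_of_mem]
        · simp [ha]
        · intro j hj
          simpa [hj, ha] using hb ⟨j, hj⟩ (Set.mem_univ _)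
      · rw [Set.indicator_of_notMem hb, Set.indicator_of_notMem]
        refine fun h => hb fun j _ => ?_
        have := h j j.2
        simpa [j.2, ha] using this
    simp only [this]
    rw [lintegral_indicator_const hU, Measure.pi_pi, Finset.prod_const, Finset.card_univ,
      Fintype.card_subtype_compl, Fintype.card_subtype_eq]
  simp only [hinner]
  have hmeas : Measurable fun y => H y * ν {z | f z < f y} ^ (Fintype.card ι - 1) := by
    refine hH.mul (Measurable.pow_const ?_ _)
    exact measurable_measure_prodMk_left (ν := ν) (s := {p : E × E | f p.2 < f p.1})
      (measurableSet_lt (by fun_prop) (by fun_prop))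
  have hlint := (measurePreserving_funUnique ν {j // j = m}).lintegral_comp hmeas
  convert hlint <;> rfl

end Product

/-- The law of the value at a sample point of the distribution function is Lebesgue measure. -/
theorem lintegral_comp_measureReal_le {E : Type*} [MeasurableSpace E] (ν : Measure E)
    [IsFiniteMeasure ν] {f : E → ℝ} (hf : Measurable f) (hν : ∀ t, ν {y | f y = t} = 0)
    {K : ℝ → ℝ≥0∞} (hK : Measurable K) :
    ∫⁻ y, K (ν.real {z | f z ≤ f y}) ∂ν = ∫⁻ u in Set.Ioo 0 (ν.real Set.univ), K u := by
  have : NullSingletonClass (ν.map f) :=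
    ⟨fun t => by rw [Measure.map_apply hf (measurableSet_singleton t)]; exact hν t⟩
  have h1 : ∀ t, (ν.map f).real (Set.Iic t) = ν.real {z | f z ≤ t} := fun t =>
    map_measureReal_apply hf measurableSet_Iic
  have h2 : (ν.map f).real Set.univ = ν.real Set.univ :=
    map_measureReal_apply hf MeasurableSet.univ
  have hF : Measurable fun t => ν.real {z | f z ≤ t} := by
    simp only [← h1]
    exact (continuous_measureReal_Iic _).measurable
  have h3 := map_measureReal_Iic (ν.map f)
  simp only [h1, h2] at h3
  rw [← h3, lintegral_map hK hF]
  exact (lintegral_map (hK.comp hF) hf).symm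

/-! ### Splitting the sample at the first cut -/

/-- The sample lies in `R`, and its points with a smaller (larger) value of `f` than the `m`-th one
are exactly those with index in `A` (outside `A`). -/
def splitEvent {E ι : Type*} (f : E → ℝ) (R : Set E) (m : ι) (A : Finset ι) : Set (ι → E) :=
  {x | (∀ j, x j ∈ R) ∧ (∀ j ∈ A, f (x j) < f (x m)) ∧ ∀ j ∉ A, j ≠ m → f (x m) < f (x j)}

open Classical in
/-- A sample without ties lies in exactly one of the split events with `l` points below. -/
theorem sum_indicator_splitEvent {E ι : Type*} [Fintype ι] {f : E → ℝ} {R : Set E} {x : ι → E} (hx : ∀ j, x j ∈ R)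
    (hinj : Function.Injective (f ∘ x)) {l : ℕ} (hl : l < Fintype.card ι)
    (h : (ι → E) → ℝ≥0∞) :
    ∑ m, ∑ A ∈ (Finset.univ.erase m).powersetCard l, (splitEvent f R m A).indicator h x = h x := by
  set below : ι → Finset ι := fun i => Finset.univ.filter fun j => f (x j) < f (x i) with hbelow
  have hmem : ∀ i j, j ∈ below i ↔ f (x j) < f (x i) := by simp [hbelow]
  have hlt : ∀ i j, f (x i) < f (x j) → (below i).card < (below j).card := by
    intro i j hij
    refine Finset.card_lt_card ⟨fun k hk => ?_, fun hsub => ?_⟩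
    · exact (hmem _ _).2 (((hmem _ _).1 hk).trans hij)
    · exact lt_irrefl _ ((hmem _ _).1 (hsub ((hmem _ _).2 hij)))
  have hcard : ∀ i, (below i).card < Fintype.card ι := fun i =>
    Finset.card_lt_univ_of_notMem (x := i) (by simp [hbelow])
  -- Without ties, ranks are an injection between finite sets of equal size, so exactly one point
  -- has rank `l`.
  have hrank : Function.Injective fun i => (⟨(below i).card, hcard i⟩ : Fin (Fintype.card ι)) := by
    intro i j hij
    have hij' : (below i).card = (below j).card := congrArg Fin.val hij
    refine hinj ?_
    rcases lt_trichotomy (f (x i)) (f (x j)) with h | h | h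
    · exact absurd (hlt _ _ h) (by omega)
    · exact h
    · exact absurd (hlt _ _ h) (by omega)
  have hsurj := ((Fintype.bijective_iff_injective_and_card _).2 ⟨hrank, by simp⟩).2
  obtain ⟨m, hm⟩ := hsurj ⟨l, hl⟩
  have hm' : (below m).card = l := congrArg Fin.val hm
  have huniq : ∀ i A, i ∉ A → x ∈ splitEvent f R i A → A = below i := by
    intro i A hiA hi
    ext j
    rw [hmem]
    refine ⟨hi.2.1 j, fun hj => ?_⟩
    by_contra hjA
    have hji : j ≠ i := fun h => by simp [h] at hj
    exact lt_asymm hj (hi.2.2 j hjA hji)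
  have hsplit : x ∈ splitEvent f R m (below m) := by
    refine ⟨hx, fun j hj => (hmem _ _).1 hj, fun j hj hjm => ?_⟩
    rw [hmem, not_lt] at hj
    exact lt_of_le_of_ne hj fun h => hjm (hinj h.symm)
  have hnot : ∀ {i : ι} {A : Finset ι}, A ∈ (Finset.univ.erase i).powersetCard l → i ∉ A ∧ A.card = l := by
    intro i A hA
    obtain ⟨h1, h2⟩ := Finset.mem_powersetCard.1 hA
    exact ⟨fun h => by simpa using h1 h, h2⟩
  rw [Finset.sum_eq_single m, Finset.sum_eq_single (below m), Set.indicator_of_mem hsplit]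
  · intro A hA hne
    exact Set.indicator_of_notMem (fun h => hne (huniq _ _ (hnot hA).1 h)) _
  · intro h
    refine absurd (Finset.mem_powersetCard.2 ⟨fun j hj => ?_, hm'⟩) h
    rw [hmem] at hj
    simp only [Finset.mem_erase, Finset.mem_univ, and_true]
    rintro rfl
    exact lt_irrefl _ hj
  · intro i _ hne
    refine Finset.sum_eq_zero fun A hA => Set.indicator_of_notMem (fun h => hne ?_) _
    refine hrank (Fin.ext ?_)
    change (below i).card = (below m).card
    rw [hm', ← huniq _ _ (hnot hA).1 h, (hnot hA).2]
  · simp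

section Split

variable {E ι : Type*} [Fintype ι] [MeasurableSpace E]

theorem measurableSet_splitEvent {f : E → ℝ} (hf : Measurable f) {R : Set E} (hR : MeasurableSet R)
    (m : ι) (A : Finset ι) : MeasurableSet (splitEvent f R m A) := by
  have : splitEvent f R m A = (⋂ j, {x | x j ∈ R}) ∩ ((⋂ j ∈ A, {x | f (x j) < f (x m)}) ∩
      ⋂ j, ⋂ (_ : j ∉ A), ⋂ (_ : j ≠ m), {x | f (x m) < f (x j)}) := by
    ext; simp [splitEvent]
  rw [this]
  refine (MeasurableSet.iInter fun j => measurable_pi_apply j hR).inter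
    ((MeasurableSet.iInter fun j => MeasurableSet.iInter fun _ => ?_).inter
      (MeasurableSet.iInter fun j => MeasurableSet.iInter fun _ => MeasurableSet.iInter fun _ => ?_))
  · exact measurableSet_lt (by fun_prop) (by fun_prop)
  · exact measurableSet_lt (by fun_prop) (by fun_prop)

/-- The contribution of a split event: the points outside `A` and `m` form a sample from the part
of `R` above the cut. -/
theorem lintegral_splitEvent [DecidableEq ι] {n : ℕ} (μ : Measure E) [IsFiniteMeasure μ] {R : Set E}
    (hR : MeasurableSet R) {T : Fin (n + 1) → E → ℝ} (hT : ∀ k, Measurable (T k))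
    (hμ : ∀ t, μ {y | T 0 y = t} = 0) (L : Fin (n + 2) → ℕ) (m : ι) {A : Finset ι} (hm : m ∉ A)
    (hA : A.card + 1 = L 0) {g : (Fin (n + 2) → ℝ) → ℝ≥0∞} (hg : Measurable g) {D : ℝ → ℝ≥0∞}
    (hD : Measurable D)
    (hint : ∀ t, ∫⁻ b : {j // ¬ (j = m ∨ j ∈ A)} → E,
      g (Fin.cons (α := fun _ => ℝ) (μ.real (R ∩ {y | T 0 y ≤ t})) fun j =>
        μ.real (rankBin b (R ∩ {y | t < T 0 y}) (Fin.tail T) (Fin.tail L) j))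
          ∂Measure.pi (fun _ => μ.restrict (R ∩ {y | t < T 0 y})) =
      D (μ.real (R ∩ {y | T 0 y ≤ t}))) :
    ∫⁻ x, (splitEvent (T 0) R m A).indicator
        (fun x => g fun j => μ.real (rankBin x R T L j)) x ∂Measure.pi (fun _ => μ.restrict R) =
      ∫⁻ u in Set.Ioo 0 (μ.real R), ENNReal.ofReal u ^ (L 0 - 1) * D u := by
  have hle : ∀ t, MeasurableSet {y | T 0 y ≤ t} := fun t => measurableSet_le (hT 0) measurable_const
  have hgt : ∀ t, MeasurableSet {y | t < T 0 y} := fun t => measurableSet_lt measurable_const (hT 0)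
  have hh : Measurable fun x : ι → E => g fun j => μ.real (rankBin x R T L j) :=
    hg.comp (measurable_measureReal_rankBin μ hR hT L)
  rw [lintegral_pi_eq_lintegral_lintegral (μ.restrict R) (fun j => j = m ∨ j ∈ A)
    (hh.indicator (measurableSet_splitEvent (hT 0) hR m A))]
  set m' : {j // j = m ∨ j ∈ A} := ⟨m, Or.inl rfl⟩ with hm'
  set low : Set ({j // j = m ∨ j ∈ A} → E) :=
    {a | ∀ j, j ≠ m' → T 0 (a j) < T 0 (a m')} with hlow
  have hinner : ∀ a : {j // j = m ∨ j ∈ A} → E, (∀ j, a j ∈ R) →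
      ∫⁻ b : {j // ¬ (j = m ∨ j ∈ A)} → E, (splitEvent (T 0) R m A).indicator
        (fun x => g fun j => μ.real (rankBin x R T L j))
        (fun j => if hj : j = m ∨ j ∈ A then a ⟨j, hj⟩ else b ⟨j, hj⟩)
          ∂Measure.pi (fun _ => μ.restrict R) =
      low.indicator (fun a => D (μ.real (R ∩ {y | T 0 y ≤ T 0 (a m')}))) a := by
    intro a haR
    set t := T 0 (a m') with ht
    set S : Set E := R ∩ {y | t < T 0 y} with hS
    have hSm : MeasurableSet S := hR.inter (hgt t)
    -- The split event is a product: `m` is the maximum within the first group, and the second group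
    -- lies in `S`, which depends on the first only through `t`.
    have hglue : ∀ b : {j // ¬ (j = m ∨ j ∈ A)} → E,
        (fun j => if hj : j = m ∨ j ∈ A then a ⟨j, hj⟩ else b ⟨j, hj⟩) ∈ splitEvent (T 0) R m A ↔
          a ∈ low ∧ b ∈ Set.univ.pi fun _ => S := by
      intro b
      constructor
      · rintro ⟨h1, h2, h3⟩
        refine ⟨fun j hj => ?_, fun j _ => ⟨?_, ?_⟩⟩
        · have hjm : (j : ι) ≠ m := fun h => hj (Subtype.ext h)
          have hjA : (j : ι) ∈ A := j.2.resolve_left hjm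
          simpa [hjA] using h2 j hjA
        · simpa [j.2] using h1 j
        · have hj := not_or.1 j.2
          simpa [hj.1, hj.2] using h3 j hj.2 hj.1
      · rintro ⟨h1, h2⟩
        refine ⟨fun j => ?_, fun j hj => ?_, fun j hj hjm => ?_⟩
        · by_cases hj : j = m ∨ j ∈ A
          · simp only [hj, dite_true]
            exact haR _
          · simp only [hj, dite_false]
            exact (h2 ⟨j, hj⟩ (Set.mem_univ _)).1
        · have hjm : j ≠ m := fun h => hm (h ▸ hj)
          simpa [hj] using h1 ⟨j, Or.inr hj⟩ fun h => hjm (congrArg Subtype.val h)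
        · have hj' : ¬ (j = m ∨ j ∈ A) := not_or.2 ⟨hjm, hj⟩
          simpa [hj, hjm] using (h2 ⟨j, hj'⟩ (Set.mem_univ _)).2
    have hcut : ∀ b : {j // ¬ (j = m ∨ j ∈ A)} → E, a ∈ low → b ∈ (Set.univ.pi fun _ => S) →
        (fun j => μ.real (rankBin
          (fun j => if hj : j = m ∨ j ∈ A then a ⟨j, hj⟩ else b ⟨j, hj⟩) R T L j)) =
        Fin.cons (α := fun _ => ℝ) (μ.real (R ∩ {y | T 0 y ≤ t}))
          fun j => μ.real (rankBin b S (Fin.tail T) (Fin.tail L) j) := by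
      intro b ha hb
      obtain ⟨h1, h2, h3⟩ := (hglue b).2 ⟨ha, hb⟩
      set x : ι → E := fun j => if hj : j = m ∨ j ∈ A then a ⟨j, hj⟩ else b ⟨j, hj⟩ with hx
      have e1 : x m = a m' := by simp [hx, hm']
      have h4 : rankCut x R (T 0) (L 0) = R ∩ {y | T 0 y ≤ t} := by
        rw [← hA, rankCut_eq_of_split x R (T 0) m A hm h1 h2 h3, e1]
        rfl
      have h5 : R \ (R ∩ {y | T 0 y ≤ t}) = S := by
        ext y
        simp [hS]
      have h6 : b = x ∘ Subtype.val := by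
        funext j
        simp [hx, j.2]
      funext j
      refine Fin.cases ?_ (fun j => ?_) j
      · rw [rankBin_zero, h4, Fin.cons_zero]
      · rw [rankBin_succ, h4, h5, Fin.cons_succ, h6,
          rankBin_comp Subtype.val Subtype.val_injective x S]
        intro j hj
        refine ⟨⟨j, fun hjA => ?_⟩, rfl⟩
        have hj' : T 0 (x m) < T 0 (x j) := by
          rw [e1]
          exact hj.2
        rcases hjA with rfl | hjA
        · exact lt_irrefl _ hj'
        · exact lt_asymm hj' (h2 j hjA)
    by_cases ha : a ∈ low
    · have hpt : ∀ b : {j // ¬ (j = m ∨ j ∈ A)} → E, (splitEvent (T 0) R m A).indicator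
          (fun x => g fun j => μ.real (rankBin x R T L j))
          (fun j => if hj : j = m ∨ j ∈ A then a ⟨j, hj⟩ else b ⟨j, hj⟩) =
          (Set.univ.pi fun _ => S).indicator (fun b => g (Fin.cons (α := fun _ => ℝ)
            (μ.real (R ∩ {y | T 0 y ≤ t})) fun j =>
              μ.real (rankBin b S (Fin.tail T) (Fin.tail L) j))) b := by
        intro b
        by_cases hb : b ∈ Set.univ.pi fun _ => S
        · rw [Set.indicator_of_mem hb, Set.indicator_of_mem ((hglue b).2 ⟨ha, hb⟩), hcut b ha hb]
        · rw [Set.indicator_of_notMem hb, Set.indicator_of_notMem fun h => hb ((hglue b).1 h).2]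
      simp only [hpt]
      -- Restricting the product measure to the box `S × ⋯ × S` gives a sample from `μ.restrict S`.
      rw [lintegral_indicator (MeasurableSet.univ_pi fun _ => hSm), Measure.restrict_pi_pi,
        Set.indicator_of_mem ha]
      have hres : (μ.restrict R).restrict S = μ.restrict S := by
        rw [Measure.restrict_restrict hSm, Set.inter_eq_left.2 Set.inter_subset_left]
      simp only [hres]
      exact hint t
    · rw [Set.indicator_of_notMem ha]
      refine (lintegral_congr fun b => ?_).trans lintegral_zero
      exact Set.indicator_of_notMem (fun h => ha ((hglue b).1 h).1) _
  have haeR : ∀ᵐ a ∂Measure.pi (fun _ : {j // j = m ∨ j ∈ A} => μ.restrict R), ∀ j, a j ∈ R :=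
    ae_all_iff.2 fun j => (Measure.quasiMeasurePreserving_eval (fun _ => μ.restrict R) j).ae
      (ae_restrict_mem hR)
  refine (lintegral_congr_ae (haeR.mono hinner)).trans ?_
  have hν : ∀ t, (μ.restrict R) {y | T 0 y = t} = 0 := fun t =>
    nonpos_iff_eq_zero.1 ((Measure.restrict_apply_le _ _).trans (hμ t).le)
  have hreal : ∀ t, μ.real (R ∩ {y | T 0 y ≤ t}) = (μ.restrict R).real {y | T 0 y ≤ t} := by
    intro t
    rw [measureReal_restrict_apply (hle t), Set.inter_comm]
  simp only [hreal]
  have hDm : Measurable fun y => D ((μ.restrict R).real {z | T 0 z ≤ T 0 y}) := by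
    refine hD.comp (Measurable.ennreal_toReal ?_)
    exact measurable_measure_prodMk_left (ν := μ.restrict R)
      (s := {p : E × E | T 0 p.2 ≤ T 0 p.1})
      (measurableSet_le ((hT 0).comp measurable_snd) ((hT 0).comp measurable_fst))
  rw [lintegral_pi_of_max (μ.restrict R) (hT 0) m' hDm]
  have hcard : Fintype.card {j // j = m ∨ j ∈ A} = L 0 := by
    rw [← hA, ← Finset.card_insert_of_notMem hm, Fintype.card_subtype]
    congr 1
    ext j
    simp
  rw [hcard]
  -- Level sets are null, so the whole integrand depends on `y` only through the distribution
  -- function.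
  have hlt : ∀ t, (μ.restrict R) {z | T 0 z < t} =
      ENNReal.ofReal ((μ.restrict R).real {z | T 0 z ≤ t}) := by
    intro t
    rw [ofReal_measureReal (measure_ne_top _ _)]
    refine le_antisymm (measure_mono fun z (hz : T 0 z < t) => hz.le) ?_
    calc (μ.restrict R) {z | T 0 z ≤ t} ≤ (μ.restrict R) ({z | T 0 z < t} ∪ {z | T 0 z = t}) :=
          measure_mono fun z (hz : T 0 z ≤ t) => lt_or_eq_of_le hz
      _ ≤ _ := (measure_union_le _ _).trans (by rw [hν t, add_zero])
  simp only [hlt]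
  have := lintegral_comp_measureReal_le (μ.restrict R) (hT 0) hν
    (K := fun u => ENNReal.ofReal u ^ (L 0 - 1) * D u) (by fun_prop)
  rw [measureReal_restrict_apply_univ] at this
  rw [← this]
  exact lintegral_congr fun y => mul_comm _ _

end Split

/-! ### Induction on the number of cuts -/

/-- The law of the masses of the bins cut by ranks, for a sample from a finite measure restricted to
a region `R`. -/
theorem lintegral_rankBin {E : Type*} [MeasurableSpace E] (μ : Measure E) [IsFiniteMeasure μ]
    (n : ℕ) : ∀ {ι : Type*} [Fintype ι] {R : Set E} (_ : MeasurableSet R) {T : Fin n → E → ℝ}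
      (_ : ∀ k, Measurable (T k)) (_ : ∀ k t, μ {y | T k y = t} = 0) (L : Fin (n + 1) → ℕ)
      (_ : ∀ j, 0 < L j) (_ : Fintype.card ι = ∑ j, L j) {g : (Fin (n + 1) → ℝ) → ℝ≥0∞}
      (_ : Measurable g),
    ∫⁻ x : ι → E, g (fun j => μ.real (rankBin x R T L j)) ∂Measure.pi (fun _ => μ.restrict R) =
      ENNReal.ofReal (simplexConst L) * simplexIntegral L (μ.real R) g := by
  classical
  induction n with
  | zero =>
    intro ι _ R hR T hT hμ L hL hcard g hg
    have hc : simplexConst L = 1 := by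
      have : ((L 0).factorial : ℝ) ≠ 0 := by positivity
      simp [simplexConst, this]
    simp only [rankBin_of_isEmpty]
    rw [lintegral_const, hc, ENNReal.ofReal_one, one_mul,
      simplexIntegral_zero L (hL 0) measureReal_nonneg, Measure.pi_univ]
    simp only [Measure.restrict_apply_univ, Finset.prod_const, Finset.card_univ, hcard,
      ofReal_measureReal (measure_ne_top μ R)]
    exact mul_comm _ _
  | succ n ih =>
    intro ι _ R hR T hT hμ L hL hcard g hg
    -- The value given by the induction hypothesis when the first bin has mass `u`.
    set D : ℝ → ℝ≥0∞ := fun u => ENNReal.ofReal (simplexConst (Fin.tail L)) *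
      simplexIntegral (Fin.tail L) (μ.real R - u) fun q => g (Fin.cons (α := fun _ => ℝ) u q)
      with hD
    have hDm : Measurable D := (measurable_simplexIntegral_cons _ _ hg).const_mul _
    have hcons : ∀ u : ℝ, Measurable fun q : Fin (n + 1) → ℝ =>
        g (Fin.cons (α := fun _ => ℝ) u q) := by
      intro u
      refine hg.comp (measurable_pi_lambda _ fun j => ?_)
      refine Fin.cases ?_ (fun j => ?_) j
      · simp only [Fin.cons_zero]; fun_prop
      · simp only [Fin.cons_succ]; fun_prop
    have hsum : ∑ j, L j = L 0 + ∑ j, Fin.tail L j := Fin.sum_univ_succ L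
    have hL0 := hL 0
    have hlt : L 0 - 1 < Fintype.card ι := by omega
    have hh : Measurable fun x : ι → E => g fun j => μ.real (rankBin x R T L j) :=
      hg.comp (measurable_measureReal_rankBin μ hR hT L)
    have hterm : ∀ m : ι, ∀ A ∈ (Finset.univ.erase m).powersetCard (L 0 - 1),
        ∫⁻ x, (splitEvent (T 0) R m A).indicator
          (fun x => g fun j => μ.real (rankBin x R T L j)) x ∂Measure.pi (fun _ => μ.restrict R) =
        ∫⁻ u in Set.Ioo 0 (μ.real R), ENNReal.ofReal u ^ (L 0 - 1) * D u := by
      intro m A hA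
      obtain ⟨h1, h2⟩ := Finset.mem_powersetCard.1 hA
      have hm : m ∉ A := fun h => by simpa using h1 h
      refine lintegral_splitEvent μ hR hT (hμ 0) L m hm (by omega) hg hDm fun t => ?_
      have hgt : MeasurableSet {y | t < T 0 y} := measurableSet_lt measurable_const (hT 0)
      have hcard' : Fintype.card {j // ¬ (j = m ∨ j ∈ A)} = ∑ j, Fin.tail L j := by
        have h3 : Fintype.card {j // j = m ∨ j ∈ A} = L 0 := by
          rw [Fintype.card_subtype]
          have : (Finset.univ.filter fun j => j = m ∨ j ∈ A) = insert m A := by ext j; simp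
          rw [this, Finset.card_insert_of_notMem hm]
          omega
        rw [Fintype.card_subtype_compl, h3]
        omega
      rw [ih (hR.inter hgt) (T := Fin.tail T) (fun k => hT _) (fun k => hμ _) (Fin.tail L)
        (fun j => hL _) hcard' (hcons _), hD]
      -- The region above the cut has mass `μ(R) - u`, so the inner integral is a function of `u`.
      have hadd := measureReal_inter_add_sdiff (μ := μ) (s := R) hgt
      have hdiff : R \ {y | t < T 0 y} = R ∩ {y | T 0 y ≤ t} := by ext y; simp
      rw [hdiff] at hadd
      beta_reduce
      rw [← hadd, add_sub_cancel_right]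
    have hν : ∀ t, (μ.restrict R) {y | T 0 y = t} = 0 := fun t =>
      nonpos_iff_eq_zero.1 ((Measure.restrict_apply_le _ _).trans (hμ 0 t).le)
    have hae : (fun x : ι → E => g fun j => μ.real (rankBin x R T L j))
        =ᵐ[Measure.pi fun _ => μ.restrict R]
        fun x => ∑ m, ∑ A ∈ (Finset.univ.erase m).powersetCard (L 0 - 1),
          (splitEvent (T 0) R m A).indicator
            (fun x => g fun j => μ.real (rankBin x R T L j)) x := by
      have haeR : ∀ᵐ a ∂Measure.pi (fun _ : ι => μ.restrict R), ∀ j, a j ∈ R :=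
        ae_all_iff.2 fun j => (Measure.quasiMeasurePreserving_eval (fun _ => μ.restrict R) j).ae
          (ae_restrict_mem hR)
      filter_upwards [haeR, ae_injective_comp (ι := ι) (μ.restrict R) (hT 0) hν] with x hx hinj
      refine (sum_indicator_splitEvent hx hinj hlt
        fun x => g fun j => μ.real (rankBin x R T L j)).symm.trans ?_
      congr!
    have hind : ∀ m A, Measurable fun x : ι → E => (splitEvent (T 0) R m A).indicator
        (fun x => g fun j => μ.real (rankBin x R T L j)) x := fun m A =>
      hh.indicator (measurableSet_splitEvent (hT 0) hR m A)
    rw [lintegral_congr_ae hae, lintegral_finsetSum _ fun m _ =>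
      Finset.measurable_sum _ fun A _ => hind m A]
    simp only [lintegral_finsetSum _ fun A _ => hind _ A]
    rw [Finset.sum_congr rfl fun m _ => Finset.sum_congr rfl (hterm m)]
    simp only [Finset.sum_const, Finset.card_powersetCard, Finset.card_erase_of_mem,
      Finset.mem_univ, Finset.card_univ, smul_smul]
    rw [simplexIntegral_succ L _ hg, simplexConst_succ L hL0, hcard,
      ENNReal.ofReal_mul (Nat.cast_nonneg _), ENNReal.ofReal_natCast, mul_assoc, nsmul_eq_mul,
      ← lintegral_const_mul' _ _ ENNReal.ofReal_ne_top]
    congr 1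
    refine lintegral_congr fun u => ?_
    rw [hD]
    ring

/-! ### The Dirichlet distribution with integer parameters -/

theorem ofReal_dirichletPDFReal {n : ℕ} {a : Fin (n + 1) → ℝ} {L : Fin (n + 1) → ℕ}
    (hL : ∀ j, 0 < L j) (ha : ∀ i : Fin n, a i.castSucc = L i.castSucc)
    (ha' : a (Fin.last n) = L (Fin.last n) + 1) (x : Fin n → ℝ) :
    ENNReal.ofReal (dirichletPDFReal a x) =
      ENNReal.ofReal (simplexConst L) * simplexWeight L 1 x := by
  classical
  have hsum : ∑ j, a j = ((∑ j, L j : ℕ) : ℝ) + 1 := by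
    rw [Fin.sum_univ_castSucc, Fin.sum_univ_castSucc, ha', Finset.sum_congr rfl fun i _ => ha i]
    push_cast
    ring
  have hpred : ∀ j, (L j : ℝ) = ((L j - 1 : ℕ) : ℝ) + 1 := by
    intro j
    have := hL j
    rw [Nat.cast_sub this]
    simp
  have hconst : Real.Gamma (∑ j, a j) / ∏ j, Real.Gamma (a j) = simplexConst L := by
    rw [hsum, Real.Gamma_nat_eq_factorial, Fin.prod_univ_castSucc, ha',
      Real.Gamma_nat_eq_factorial, simplexConst]
    congr 2
    push_cast
    refine Finset.prod_congr rfl fun i _ => ?_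
    rw [ha, hpred, Real.Gamma_nat_eq_factorial]
  have hconst0 : 0 ≤ simplexConst L := by unfold simplexConst; positivity
  unfold dirichletPDFReal simplexWeight
  split_ifs with h
  · have hpow : ∀ i, x i ^ (a i.castSucc - 1) = x i ^ (L i.castSucc - 1) := by
      intro i
      rw [ha, hpred, add_sub_cancel_right, Real.rpow_natCast]
    simp only [hpow]
    rw [hconst, ha', add_sub_cancel_right, Real.rpow_natCast, ENNReal.ofReal_mul hconst0,
      ENNReal.ofReal_mul (Finset.prod_nonneg fun i _ => pow_nonneg (h.1 i).le _),
      ENNReal.ofReal_prod_of_nonneg fun i _ => pow_nonneg (h.1 i).le _,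
      ENNReal.ofReal_pow (sub_nonneg.2 h.2.le)]
    congr 2
    exact Finset.prod_congr rfl fun i _ => ENNReal.ofReal_pow (h.1 i).le _
  · simp

theorem lintegral_dirichletMeasure {n : ℕ} {a : Fin (n + 1) → ℝ} {L : Fin (n + 1) → ℕ}
    (hL : ∀ j, 0 < L j) (ha : ∀ i : Fin n, a i.castSucc = L i.castSucc)
    (ha' : a (Fin.last n) = L (Fin.last n) + 1) {g : (Fin (n + 1) → ℝ) → ℝ≥0∞}
    (hg : Measurable g) :
    ∫⁻ p, g p ∂dirichletMeasure a = ENNReal.ofReal (simplexConst L) * simplexIntegral L 1 g := by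
  have hw : Measurable fun x : Fin n → ℝ => simplexWeight L 1 x :=
    (measurable_simplexWeight L).comp (measurable_const.prodMk measurable_id)
  have hs := measurable_snoc_sub (n := n) 1
  rw [dirichletMeasure, lintegral_map hg hs]
  simp only [ofReal_dirichletPDFReal hL ha ha']
  refine (lintegral_withDensity_eq_lintegral_mul _ (hw.const_mul _) (hg.comp hs)).trans ?_
  rw [simplexIntegral,
    ← lintegral_const_mul' _ _ ENNReal.ofReal_ne_top]
  exact lintegral_congr fun x => mul_assoc _ _ _

theorem measure_signedComponent_eq {d : ℕ} {φ₀ : Measure (Fin d → ℝ)}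
    (hφ₀ : ∀ (i : Fin d) (t : ℝ), φ₀ {y | y i = t} = 0) (c : Fin d × Bool) (t : ℝ) :
    φ₀ {y | signedComponent c y = t} = 0 := by
  unfold signedComponent
  split_ifs
  · simpa only [neg_eq_iff_eq_neg] using hφ₀ c.1 (-t)
  · exact hφ₀ c.1 t

end QuantTree

end

theorem proposition1 {Ω : Type*} [MeasurableSpace Ω] (P : Measure Ω) [IsProbabilityMeasure P]
    {d N n : ℕ} (hN : 0 < N)
    -- the distribution `φ₀` on `ℝ^d`, with continuous one-dimensional marginals
    (φ₀ : Measure (Fin d → ℝ)) [IsProbabilityMeasure φ₀]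
    (hφ₀ : ∀ (i : Fin d) (t : ℝ), φ₀ {y | y i = t} = 0)
    -- the target probabilities of the `K = n + 1` bins, such that each `π j * N` is an integer
    (π : Fin (n + 1) → ℝ) (hπ_pos : ∀ j, 0 < π j) (hπ_sum : ∑ j, π j = 1)
    (L : Fin (n + 1) → ℕ) (hL : ∀ j, (L j : ℝ) = π j * N)
    -- the training set: `N` i.i.d. samples from `φ₀`
    (X : Fin N → Ω → (Fin d → ℝ)) (hX_law : ∀ m, HasLaw (X m) φ₀ P) (hX_indep : iIndepFun X P)
    -- the random choices of the algorithm (any law), independent of the training set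
    (C : Ω → (Fin n → Fin d × Bool)) (hC : Measurable C)
    (hCX : IndepFun C (fun ω m => X m ω) P) :
    HasLaw (fun ω (j : Fin (n + 1)) => φ₀.real (QuantTree.bin (fun m => X m ω) (C ω) L j))
      (dirichletMeasure (QuantTree.dirichletParam π N)) P := by
  have hLpos : ∀ j, 0 < L j := by
    intro j
    have h : (0 : ℝ) < L j := by
      rw [hL]
      exact mul_pos (hπ_pos j) (Nat.cast_pos.2 hN)
    exact_mod_cast h
  have hLsum : ∑ j, L j = N := by
    have h : ((∑ j, L j : ℕ) : ℝ) = N := by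
      push_cast
      simp only [hL]
      rw [← Finset.sum_mul, hπ_sum, one_mul]
    exact_mod_cast h
  have hXm : AEMeasurable (fun ω m => X m ω) P := aemeasurable_pi_lambda _ fun m =>
    (hX_law m).aemeasurable
  have hXmap : P.map (fun ω m => X m ω) = Measure.pi fun _ => φ₀ := by
    rw [(iIndepFun_iff_map_fun_eq_pi_map fun m => (hX_law m).aemeasurable).1 hX_indep]
    simp only [(hX_law _).map_eq]
  have hpair : P.map (fun ω => (C ω, fun m => X m ω)) = (P.map C).prod (Measure.pi fun _ => φ₀) := by
    rw [← hXmap]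
    exact (indepFun_iff_map_prod_eq_prod_map_map hC.aemeasurable hXm).1 hCX
  have hpairm : AEMeasurable (fun ω => (C ω, fun m => X m ω)) P := hC.aemeasurable.prodMk hXm
  have : IsProbabilityMeasure (P.map C) := Measure.isProbabilityMeasure_map hC.aemeasurable
  -- The rank version is measurable in choices and sample together, and agrees with the bin masses
  -- off the null event of ties.
  let F : (Fin n → Fin d × Bool) × (Fin N → Fin d → ℝ) → Fin (n + 1) → ℝ := fun p j =>
    φ₀.real (QuantTree.rankBin p.2 Set.univ (fun k => QuantTree.signedComponent (p.1 k)) L j)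
  have hF : Measurable F := measurable_from_prod_countable_right fun c =>
    QuantTree.measurable_measureReal_rankBin φ₀ MeasurableSet.univ
      (fun k => QuantTree.measurable_signedComponent (c k)) L
  have hinj : ∀ᵐ ω ∂P, ∀ c : Fin d × Bool,
      Function.Injective (QuantTree.signedComponent c ∘ fun m => X m ω) := by
    refine ae_of_ae_map (p := fun x : Fin N → Fin d → ℝ => ∀ c : Fin d × Bool,
      Function.Injective (QuantTree.signedComponent c ∘ x)) hXm ?_
    rw [hXmap]
    exact ae_all_iff.2 fun c => QuantTree.ae_injective_comp φ₀
      (QuantTree.measurable_signedComponent c) (QuantTree.measure_signedComponent_eq hφ₀ c)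
  have hae : (fun ω (j : Fin (n + 1)) => φ₀.real (QuantTree.bin (fun m => X m ω) (C ω) L j))
      =ᵐ[P] F ∘ fun ω => (C ω, fun m => X m ω) := by
    filter_upwards [hinj] with ω hω
    funext j
    rw [QuantTree.bin_eq_rankBin _ _ L hLpos hLsum fun k => hω (C ω k)]
    rfl
  refine ⟨(hF.comp_aemeasurable hpairm).congr hae.symm, ?_⟩
  rw [Measure.map_congr hae, ← AEMeasurable.map_map_of_aemeasurable hF.aemeasurable hpairm, hpair]
  refine Measure.ext_of_lintegral _ fun g hg => ?_
  rw [lintegral_map hg hF]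
  -- By independence the sample is integrated out first, for fixed choices `c`; the result does not
  -- depend on `c`.
  refine (lintegral_prod _ (hg.comp hF).aemeasurable).trans ?_
  have hinner : ∀ c, ∫⁻ x, g (F (c, x)) ∂Measure.pi (fun _ => φ₀) =
      ∫⁻ p, g p ∂dirichletMeasure (QuantTree.dirichletParam π N) := by
    intro c
    have h := QuantTree.lintegral_rankBin φ₀ n (ι := Fin N) MeasurableSet.univ
      (fun k => QuantTree.measurable_signedComponent (c k))
      (fun k => QuantTree.measure_signedComponent_eq hφ₀ (c k)) L hLpos (by simp [hLsum]) hg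
    rw [Measure.restrict_univ, probReal_univ] at h
    rw [QuantTree.lintegral_dirichletMeasure hLpos _ _ hg, ← h]
    · intro i
      rw [QuantTree.dirichletParam, if_neg (Fin.castSucc_lt_last i).ne, hL]
    · rw [QuantTree.dirichletParam, if_pos rfl, hL]
  simp only [Function.comp_apply, hinner, lintegral_const, measure_univ, mul_one]
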